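/- For $x,y\in\{0,1\}^n$ let $\mathrm{HAM}(x,y)$ be the number of coordinates in which $x$ and $y$ differ, and let $\mathrm{HAM}_n^{(a)}:\{0,1\}^n\times\{0,1\}^n\to\{0,1\}$ be the function with $\mathrm{HAM}_n^{(a)}(x,y)=1$ if and only if $\mathrm{HAM}(x,y)\le a$. Alice holds $x$, Bob holds $y$, and at the end of a protocol for $f:\{0,1\}^n\times\{0,1\}^n\to\{0,1\}$ both have to know $f(x,y)$, without error, for all $x,y$. Let $D(f)$ be the least worst-case number of bits sent by a deterministic protocol for $f$ (a decision tree, each inner node of which is owned by Alice or Bob). Let $C^*(f)$ be the least worst-case number of classical bits sent by an error-free quantum protocol for $f$ over a classical channel, and $Q^*(f)$ the least number of qubits sent by an error-free quantum protocol for $f$ over a quantum channel, where in both cases Alice and Bob may share in advance any number of EPR pairs and use any number of private qubits. Then there is an $N$ such that for all $n\ge N$ and all integers $a$ with $0\le a\le n-1$: 1. $D(\mathrm{HAM}_n^{(a)})\ge n-2$; 2. $Q^*(\mathrm{HAM}_n^{(a)})\ge \frac n2-1$; 3. $C^*(\mathrm{HAM}_n^{(a)})\ge n-2$. -/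

import Mathlib

noncomputable section

namespace CommComplexity

/-! ### The threshold Hamming-distance function -/

/-- The function `HAM_n^{(a)}` on pairs of `n`-bit strings: it outputs `1` if and only if `x` and
`y` differ in at most `a` coordinates. -/
def ham (n a : ℕ) (x y : Fin n → Bool) : Bool := decide (hammingDist x y ≤ a)

/-! ### Deterministic protocols -/

/-- A deterministic two-party protocol (a decision tree), Alice holding an element of `X` and Bob
an element of `Y`. At an inner node the owner sends one bit, which depends on the owner's input
(and, through the position in the tree, on the bits sent so far). A leaf carries the output, which
both parties know, as both know all the bits sent. -/
inductive DetProtocol (X Y : Type) : Type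
  | output (b : Bool) : DetProtocol X Y
  | alice (msg : X → Bool) (next : Bool → DetProtocol X Y) : DetProtocol X Y
  | bob (msg : Y → Bool) (next : Bool → DetProtocol X Y) : DetProtocol X Y

namespace DetProtocol

variable {X Y : Type}

/-- The output of the protocol on inputs `x`, `y`. -/
def run : DetProtocol X Y → X → Y → Bool
  | output b, _, _ => b
  | alice msg next, x, y => (next (msg x)).run x y
  | bob msg next, x, y => (next (msg y)).run x y

/-- The number of bits sent, in the worst case. -/
def cost : DetProtocol X Y → ℕ
  | output _ => 0
  | alice _ next => max (next false).cost (next true).cost + 1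
  | bob _ next => max (next false).cost (next true).cost + 1

/-- The protocol computes `f`. -/
def Computes (P : DetProtocol X Y) (f : X → Y → Bool) : Prop := ∀ x y, P.run x y = f x y

end DetProtocol

/-- `D(f)`: the least number of bits sent by a deterministic protocol that computes `f`. -/
def D {X Y : Type} (f : X → Y → Bool) : ℕ∞ :=
  ⨅ (P : DetProtocol X Y) (_ : P.Computes f), (P.cost : ℕ∞)

/-! ### States, measurements, shared EPR pairs

A (pure, not necessarily normalized) joint state `∑ s t, ψ s t |s⟩ ⊗ |t⟩` of Alice's `a` qubits and
Bob's `b` qubits is written as the matrix `ψ : Matrix (Basis a) (Basis b) ℂ` of its amplitudes: rows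
belong to Alice, columns to Bob. -/

/-- The computational basis states of a register of `k` qubits. -/
abbrev Basis (k : ℕ) : Type := Fin k → Bool

/-- The operator `A ⊗ 1`: Alice applies `A` to her register. (This is the matrix product `A ψ`.) -/
def applyAlice {a b : ℕ} (A : Matrix (Basis a) (Basis a) ℂ) (ψ : Matrix (Basis a) (Basis b) ℂ) :
    Matrix (Basis a) (Basis b) ℂ := fun s t => ∑ r, A s r * ψ r t

/-- The operator `1 ⊗ B`: Bob applies `B` to his register. (This is the matrix product `ψ Bᵀ`.) -/
def applyBob {a b : ℕ} (B : Matrix (Basis b) (Basis b) ℂ) (ψ : Matrix (Basis a) (Basis b) ℂ) :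
    Matrix (Basis a) (Basis b) ℂ := fun s t => ∑ r, B t r * ψ s r

/-- The squared Euclidean norm of a joint state. -/
def normSq {a b : ℕ} (ψ : Matrix (Basis a) (Basis b) ℂ) : ℝ := ∑ s, ∑ t, ‖ψ s t‖ ^ 2

/-- A two-outcome quantum measurement on `k` qubits, given by its measurement operators:
on a state `φ` outcome `o` has probability `‖K o φ‖²` and leaves the state `K o φ`, up to
normalization. -/
structure Measurement (k : ℕ) : Type where
  K : Bool → Matrix (Basis k) (Basis k) ℂ
  complete : (K false).conjTranspose * K false + (K true).conjTranspose * K true = 1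

/-- The initial state: `m` shared EPR pairs `(|00⟩ + |11⟩)/√2`, together with `v` private qubits of
Alice and `w` private qubits of Bob, all in state `|0⟩`. -/
def initial (m v w : ℕ) : Matrix (Basis (m + v)) (Basis (m + w)) ℂ := fun s t =>
  if (∀ i : Fin m, s (Fin.castAdd v i) = t (Fin.castAdd w i)) ∧
      (∀ j : Fin v, s (Fin.natAdd m j) = false) ∧ (∀ j : Fin w, t (Fin.natAdd m j) = false)
  then (((1 / Real.sqrt 2) ^ m : ℝ) : ℂ) else 0

/-! ### Shared entanglement and a classical channel -/

/-- A protocol over a classical channel in which Alice has a register of `a` qubits and Bob one of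
`b` qubits, possibly entangled. At an inner node the owner measures the own register (by a
measurement that depends on the owner's input and, through the position in the tree, on the bits
sent so far) and sends the outcome, one classical bit. At a leaf, each party obtains an output bit
by a final measurement of the own register. -/
inductive ClassicalChannelProtocol (X Y : Type) (a b : ℕ) : Type
  | output (MA : X → Measurement a) (MB : Y → Measurement b) : ClassicalChannelProtocol X Y a b
  | alice (M : X → Measurement a) (next : Bool → ClassicalChannelProtocol X Y a b) :
      ClassicalChannelProtocol X Y a b
  | bob (M : Y → Measurement b) (next : Bool → ClassicalChannelProtocol X Y a b) :
      ClassicalChannelProtocol X Y a b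

namespace ClassicalChannelProtocol

variable {X Y : Type} {a b : ℕ}

/-- The probability that, from joint state `ψ` and on inputs `x`, `y`, both parties output `o`.
(Intermediate states are not renormalized, so this is a sum over the bits sent of the squared norm
of the corresponding final state.) -/
def prob : ClassicalChannelProtocol X Y a b → Matrix (Basis a) (Basis b) ℂ → X → Y → Bool → ℝ
  | output MA MB, ψ, x, y, o => normSq (applyAlice ((MA x).K o) (applyBob ((MB y).K o) ψ))
  | alice M next, ψ, x, y, o =>
      (next false).prob (applyAlice ((M x).K false) ψ) x y o + (next true).prob (applyAlice ((M x).K true) ψ) x y o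
  | bob M next, ψ, x, y, o =>
      (next false).prob (applyBob ((M y).K false) ψ) x y o +
        (next true).prob (applyBob ((M y).K true) ψ) x y o

/-- The number of classical bits sent, in the worst case. -/
def cost : ClassicalChannelProtocol X Y a b → ℕ
  | output _ _ => 0
  | alice _ next => max (next false).cost (next true).cost + 1
  | bob _ next => max (next false).cost (next true).cost + 1

/-- Started in `ψ`, the protocol computes `f` without error: on all inputs both parties output the
value of `f` with probability `1`. -/
def Computes (P : ClassicalChannelProtocol X Y a b) (ψ : Matrix (Basis a) (Basis b) ℂ) (f : X → Y → Bool) : Prop :=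
  ∀ x y, P.prob ψ x y (f x y) = 1

end ClassicalChannelProtocol

/-- `C*(f)`: the least number of classical bits sent by an error-free quantum protocol for `f` over
a classical channel, with any number of shared EPR pairs and of private qubits. -/
def CStar {X Y : Type} (f : X → Y → Bool) : ℕ∞ :=
  ⨅ (m : ℕ) (v : ℕ) (w : ℕ) (P : ClassicalChannelProtocol X Y (m + v) (m + w))
    (_ : P.Computes (initial m v w) f), (P.cost : ℕ∞)

/-! ### Shared entanglement and a quantum channel -/

/-- Alice's first qubit is handed over to Bob, where it becomes the first qubit. -/
def toBob {a b : ℕ} (ψ : Matrix (Basis (a + 1)) (Basis b) ℂ) : Matrix (Basis a) (Basis (b + 1)) ℂ :=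
  fun s t => ψ (Fin.cons (t 0) s) (Fin.tail t)

/-- Bob's first qubit is handed over to Alice, where it becomes the first qubit. -/
def toAlice {a b : ℕ} (ψ : Matrix (Basis a) (Basis (b + 1)) ℂ) : Matrix (Basis (a + 1)) (Basis b) ℂ :=
  fun s t => ψ (Fin.tail s) (Fin.cons (s 0) t)

/-- A protocol over a quantum channel, at a moment when Alice holds `a` and Bob holds `b` qubits.
In each step one party (the order is fixed in advance) applies to the qubits it holds a unitary
that depends on its input, and then sends one of them to the other party. In the end each party
obtains an output bit by measuring the qubits that it holds. -/
inductive QuantumChannelProtocol (X Y : Type) : ℕ → ℕ → Type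
  | output {a b : ℕ} (MA : X → Measurement a) (MB : Y → Measurement b) :
      QuantumChannelProtocol X Y a b
  | alice {a b : ℕ} (U : X → Matrix.unitaryGroup (Basis (a + 1)) ℂ)
      (next : QuantumChannelProtocol X Y a (b + 1)) : QuantumChannelProtocol X Y (a + 1) b
  | bob {a b : ℕ} (U : Y → Matrix.unitaryGroup (Basis (b + 1)) ℂ)
      (next : QuantumChannelProtocol X Y (a + 1) b) : QuantumChannelProtocol X Y a (b + 1)

namespace QuantumChannelProtocol

variable {X Y : Type}

/-- The probability that, from joint state `ψ` and on inputs `x`, `y`, both parties output `o`. -/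
def prob {a b : ℕ} : QuantumChannelProtocol X Y a b → Matrix (Basis a) (Basis b) ℂ → X → Y → Bool → ℝ
  | output MA MB, ψ, x, y, o => normSq (applyAlice ((MA x).K o) (applyBob ((MB y).K o) ψ))
  | alice U next, ψ, x, y, o => next.prob (toBob (applyAlice (U x).1 ψ)) x y o
  | bob U next, ψ, x, y, o =>
      next.prob (toAlice (applyBob (U y).1 ψ)) x y o

/-- The number of qubits sent. -/
def cost {a b : ℕ} : QuantumChannelProtocol X Y a b → ℕ
  | output _ _ => 0
  | alice _ next => next.cost + 1
  | bob _ next => next.cost + 1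

/-- Started in `ψ`, the protocol computes `f` without error: on all inputs both parties output the
value of `f` with probability `1`. -/
def Computes {a b : ℕ} (P : QuantumChannelProtocol X Y a b) (ψ : Matrix (Basis a) (Basis b) ℂ)
    (f : X → Y → Bool) : Prop :=
  ∀ x y, P.prob ψ x y (f x y) = 1

end QuantumChannelProtocol

/-- `Q*(f)`: the least number of qubits sent by an error-free quantum protocol for `f` over a
quantum channel, with any number of shared EPR pairs and of private qubits. -/
def QStar {X Y : Type} (f : X → Y → Bool) : ℕ∞ :=
  ⨅ (m : ℕ) (v : ℕ) (w : ℕ) (P : QuantumChannelProtocol X Y (m + v) (m + w))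
    (_ : P.Computes (initial m v w) f), (P.cost : ℕ∞)

end CommComplexity

end

/-! This is the log rank bound in operator form. Fix a protocol and let `L x y` be the sum of `Wᴴ W`
over the operators `W` leading to both parties outputting 1. Absence of error makes the starting
state `ψ` an eigenvector: `L x y ψ = f x y • ψ` (`effect_of_certain`). Operators depending on one
input only do not raise the operator rank across the cut between `x` and `y`; a classical bit at
most doubles it and a qubit at most quadruples it (`hasOperatorRank_effect`). Testing on `ψ` gives
rank `f` ≤ operator rank (`HasOperatorRank.card_le`), whatever the number of EPR pairs and private
qubits.

For the rank of `ham n a`: the function depends only on the bitwise sum of the inputs, so the Walsh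
characters diagonalize it, with the Fourier coefficients of a Hamming ball as eigenvalues, up to the
factor `2 ^ n`. For `S ≠ 0` these are coefficients of `(1 - X)^i (1 + X)^j`, and two consecutive
ones never both vanish. Hence of any two characters differing only at the first coordinate at least
one has a nonzero eigenvalue (`exists_ballFourier_cons_ne_zero`), and the rank is at least `2 ^ (n -
1)`. -/

namespace CommComplexity

open Matrix

/-! ### Operator rank across the cut, and the rank bound. -/

section OperatorRank

variable {X Y : Type} {α β : Type*} [Fintype α] [Fintype β]

/-- A family `L x y` of linear operators on `α × β` matrices has operator rank at most `N`, across
the cut between `x` and `y`, if it is a sum of at most `N` terms `ψ ↦ E x * ψ * G y`. -/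
def HasOperatorRank (N : ℕ) (L : X → Y → Matrix α β ℂ → Matrix α β ℂ) : Prop :=
  ∃ (ι : Type) (_ : Fintype ι) (E : ι → X → Matrix α α ℂ) (G : ι → Y → Matrix β β ℂ),
    Fintype.card ι ≤ N ∧ ∀ x y ψ, L x y ψ = ∑ i, E i x * ψ * G i y

namespace HasOperatorRank

variable {N M : ℕ} {L L' : X → Y → Matrix α β ℂ → Matrix α β ℂ}

theorem mono (h : HasOperatorRank N L) (hNM : N ≤ M) : HasOperatorRank M L := by
  obtain ⟨ι, hι, E, G, hc, hL⟩ := h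
  exact ⟨ι, hι, E, G, hc.trans hNM, hL⟩

theorem add (h : HasOperatorRank N L) (h' : HasOperatorRank M L') :
    HasOperatorRank (N + M) (fun x y ψ => L x y ψ + L' x y ψ) := by
  obtain ⟨ι, hι, E, G, hc, hL⟩ := h
  obtain ⟨κ, hκ, E', G', hc', hL'⟩ := h'
  refine ⟨ι ⊕ κ, inferInstance, Sum.elim E E', Sum.elim G G', ?_, fun x y ψ => ?_⟩
  · rw [Fintype.card_sum]; omega
  · simp [hL, hL']

theorem mul_left (h : HasOperatorRank N L) (A B : X → Matrix α α ℂ) :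
    HasOperatorRank N (fun x y ψ => A x * L x y (B x * ψ)) := by
  obtain ⟨ι, hι, E, G, hc, hL⟩ := h
  refine ⟨ι, hι, fun i x => A x * E i x * B x, G, hc, fun x y ψ => ?_⟩
  simp only [hL, Matrix.mul_sum, Matrix.mul_assoc]

theorem mul_right (h : HasOperatorRank N L) (A B : Y → Matrix β β ℂ) :
    HasOperatorRank N (fun x y ψ => L x y (ψ * B y) * A y) := by
  obtain ⟨ι, hι, E, G, hc, hL⟩ := h
  refine ⟨ι, hι, E, fun i y => B y * G i y * A y, hc, fun x y ψ => ?_⟩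
  simp only [hL, Matrix.sum_mul, Matrix.mul_assoc]

/-- Conjugation by maps of operator rank two multiplies the operator rank by four. -/
theorem conj {α' β' : Type*} [Fintype α'] [Fintype β'] (h : HasOperatorRank N L)
    (R : Bool → Matrix α α' ℂ) (S : Bool → Matrix β' β ℂ)
    (R' : Bool → Matrix α' α ℂ) (S' : Bool → Matrix β β' ℂ) :
    HasOperatorRank (4 * N)
      (fun x y (ψ : Matrix α' β' ℂ) => ∑ j, R' j * L x y (∑ i, R i * ψ * S i) * S' j) := by
  obtain ⟨ι, hι, E, G, hc, hL⟩ := h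
  refine ⟨Bool × Bool × ι, inferInstance, fun p x => R' p.1 * E p.2.2 x * R p.2.1,
    fun p y => S p.2.1 * G p.2.2 y * S' p.1, ?_, fun x y ψ => ?_⟩
  · simp only [Fintype.card_prod, Fintype.card_bool]; omega
  · simp only [hL, Fintype.sum_prod_type, Matrix.mul_sum, Matrix.sum_mul, Matrix.mul_assoc]
    exact Finset.sum_congr rfl fun j _ => Finset.sum_comm

/-- If a nonzero `ψ` is an eigenvector of all `L x y`, with eigenvalues `f x y`, then the rank
of `f` is at most the operator rank of `L`. The rank is bounded below through a change of basis
to a diagonal matrix without zeros. -/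
theorem card_le [Fintype X] [Fintype Y] (h : HasOperatorRank N L) {f : X → Y → ℂ}
    {ψ : Matrix α β ℂ} (hψ : ψ ≠ 0) (hf : ∀ x y, L x y ψ = f x y • ψ)
    {U : Type*} [Fintype U] [DecidableEq U] (p : U → X → ℂ) (q : U → Y → ℂ) (c : U → ℂ)
    (hc : ∀ u, c u ≠ 0)
    (hpq : ∀ u v, ∑ x, ∑ y, p u x * f x y * q v y = if u = v then c u else 0) :
    Fintype.card U ≤ N := by
  classical
  obtain ⟨ι, hι, E, G, hcard, hL⟩ := h
  refine le_trans ?_ hcard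
  -- Averaging against `p`, `q` and dividing by `c` turns the diagonal matrix into the identity.
  let E' : ι → U → Matrix α α ℂ := fun i u => (c u)⁻¹ • ∑ x, p u x • E i x
  let G' : ι → U → Matrix β β ℂ := fun i v => ∑ y, q v y • G i y
  have key : ∀ u v, ∑ i, E' i u * ψ * G' i v = if u = v then ψ else 0 := by
    intro u v
    have h1 : ∑ i, E' i u * ψ * G' i v
        = (c u)⁻¹ • ∑ x, ∑ y, (p u x * q v y) • L x y ψ := by
      simp only [E', G', hL, Matrix.smul_mul, Matrix.sum_mul, Matrix.mul_sum, Matrix.mul_smul,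
        Finset.smul_sum, smul_smul]
      rw [Finset.sum_comm, Finset.sum_congr rfl fun y _ => Finset.sum_comm, Finset.sum_comm]
      refine Finset.sum_congr rfl fun x _ => Finset.sum_congr rfl fun y _ =>
        Finset.sum_congr rfl fun i _ => ?_
      congr 1
      ring
    rw [h1]
    simp only [hf, smul_smul, ← Finset.sum_smul]
    have h2 := hpq u v
    simp only [mul_right_comm] at h2 ⊢
    rw [h2]
    split_ifs with huv
    · rw [inv_mul_cancel₀ (hc u), one_smul]
    · simp
  -- In block form `key` says `E' (1_ι ⊗ ψ) G' = 1_U ⊗ ψ`, so `|U| · rank ψ ≤ |ι| · rank ψ`. The map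
  -- `A` below realizes this on the range `W` of `ψ`, with `s` a linear section of `ψ` over `W`.
  let T := ψ.mulVecLin
  let W := LinearMap.range T
  obtain ⟨s, hs⟩ := T.rangeRestrict.exists_rightInverse_of_surjective
    (LinearMap.range_eq_top.2 T.surjective_rangeRestrict)
  have hs' : ∀ w : W, ψ *ᵥ s w = w := fun w => by
    have := congrArg Subtype.val (LinearMap.congr_fun hs w)
    simpa [T] using this
  let A : (U → W) →ₗ[ℂ] (ι → W) := LinearMap.pi fun i =>
    ∑ v, T.rangeRestrict ∘ₗ (G' i v).mulVecLin ∘ₗ s ∘ₗ LinearMap.proj v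
  have hA : ∀ w i, ((A w i : W) : α → ℂ) = ∑ v, ψ *ᵥ (G' i v *ᵥ s (w v)) := by
    intro w i
    simp [A, T]
  have hinj : Function.Injective A := by
    -- The left inverse applies `E'`. For general `z` the result may leave `W`; `invFun` followed by
    -- `ψ` forces it back and fixes vectors already in `W`.
    refine Function.LeftInverse.injective (g := fun z u =>
      T.rangeRestrict (Function.invFun (fun v => ψ *ᵥ v) (∑ i, E' i u *ᵥ (z i : α → ℂ)))) ?_
    intro w
    funext u
    have h1 : ∑ i, E' i u *ᵥ ((A w i : W) : α → ℂ) = w u := by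
      simp only [hA, Matrix.mulVec_sum, Matrix.mulVec_mulVec, ← Matrix.mul_assoc]
      rw [Finset.sum_comm]
      simp only [← Matrix.sum_mulVec, key]
      rw [Finset.sum_eq_single u]
      · simp [hs']
      · intro v _ hv
        simp [hv.symm]
      · simp
    apply Subtype.ext
    dsimp only
    rw [h1]
    exact Function.invFun_eq (f := fun v => ψ *ᵥ v) ⟨s (w u), hs' (w u)⟩
  have hle := LinearMap.finrank_le_finrank_of_injective hinj
  -- The common factor `rank ψ` can be cancelled because `ψ ≠ 0`.
  have hW : 0 < Module.finrank ℂ W := by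
    rw [Nat.pos_iff_ne_zero]
    intro h0
    have hW0 : W = ⊥ := Submodule.finrank_eq_zero.1 h0
    apply hψ
    have : T = 0 := LinearMap.range_eq_bot.1 hW0
    ext a b
    have h3 := congrFun (LinearMap.congr_fun this (Pi.single b 1)) a
    simpa [T] using h3
  simp only [Module.finrank_pi_fintype, Finset.sum_const, Finset.card_univ, smul_eq_mul] at hle
  exact Nat.le_of_mul_le_mul_right hle hW

end HasOperatorRank

end OperatorRank

/-! ### Norms, measurements and the transfer of a qubit, in matrix form. -/

section States

variable {a b : ℕ}

theorem applyAlice_eq_mul (A : Matrix (Basis a) (Basis a) ℂ) (ψ : Matrix (Basis a) (Basis b) ℂ) :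
    applyAlice A ψ = A * ψ := by
  ext s t
  simp [applyAlice, Matrix.mul_apply]

theorem applyBob_eq_mul (B : Matrix (Basis b) (Basis b) ℂ) (ψ : Matrix (Basis a) (Basis b) ℂ) :
    applyBob B ψ = ψ * Bᵀ := by
  ext s t
  simp [applyBob, Matrix.mul_apply, mul_comm]

theorem normSq_nonneg (ψ : Matrix (Basis a) (Basis b) ℂ) : 0 ≤ normSq ψ :=
  Finset.sum_nonneg fun _ _ => Finset.sum_nonneg fun _ _ => by positivity

theorem normSq_zero : normSq (0 : Matrix (Basis a) (Basis b) ℂ) = 0 := by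
  simp [normSq]

theorem eq_zero_of_normSq_eq_zero {ψ : Matrix (Basis a) (Basis b) ℂ} (h : normSq ψ = 0) :
    ψ = 0 := by
  ext s t
  have h1 := (Finset.sum_eq_zero_iff_of_nonneg fun s _ =>
    Finset.sum_nonneg fun t _ => by positivity).1 h s (Finset.mem_univ s)
  have h2 := (Finset.sum_eq_zero_iff_of_nonneg fun t _ => by positivity).1 h1 t (Finset.mem_univ t)
  simpa using h2

theorem normSq_transpose (ψ : Matrix (Basis a) (Basis b) ℂ) : normSq ψᵀ = normSq ψ :=
  Finset.sum_comm

theorem ofReal_normSq (ψ : Matrix (Basis a) (Basis b) ℂ) :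
    ((normSq ψ : ℝ) : ℂ) = (ψᴴ * ψ).trace := by
  simp only [normSq, Matrix.trace, Matrix.diag, Matrix.mul_apply, Matrix.conjTranspose_apply]
  rw [Finset.sum_comm]
  push_cast
  refine Finset.sum_congr rfl fun _ _ => Finset.sum_congr rfl fun _ _ => ?_
  rw [Complex.star_def, Complex.conj_mul']

theorem normSq_mul_unitary {U : Matrix (Basis a) (Basis a) ℂ} (hU : Uᴴ * U = 1)
    (ψ : Matrix (Basis a) (Basis b) ℂ) : normSq (U * ψ) = normSq ψ := by
  have h : ((normSq (U * ψ) : ℝ) : ℂ) = normSq ψ := by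
    rw [ofReal_normSq, ofReal_normSq, Matrix.conjTranspose_mul, Matrix.mul_assoc,
      ← Matrix.mul_assoc Uᴴ, hU, Matrix.one_mul]
  exact_mod_cast h

theorem Measurement.normSq_add (M : Measurement a) (ψ : Matrix (Basis a) (Basis b) ℂ) :
    normSq (M.K false * ψ) + normSq (M.K true * ψ) = normSq ψ := by
  have h : ((normSq (M.K false * ψ) + normSq (M.K true * ψ) : ℝ) : ℂ) = normSq ψ := by
    push_cast
    rw [ofReal_normSq, ofReal_normSq, ofReal_normSq, ← Matrix.trace_add]
    simp only [Matrix.conjTranspose_mul, Matrix.mul_assoc]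
    rw [← Matrix.mul_add]
    simp only [← Matrix.mul_assoc (M.K _)ᴴ]
    rw [← Matrix.add_mul, M.complete, Matrix.one_mul]
  exact_mod_cast h

theorem Measurement.normSq_add_right (M : Measurement b) (ψ : Matrix (Basis a) (Basis b) ℂ) :
    normSq (ψ * (M.K false)ᵀ) + normSq (ψ * (M.K true)ᵀ) = normSq ψ := by
  have h := M.normSq_add ψᵀ
  rwa [← normSq_transpose, ← normSq_transpose (M.K true * _), normSq_transpose ψ,
    Matrix.transpose_mul, Matrix.transpose_mul, Matrix.transpose_transpose] at h

theorem Measurement.sum_conj (M : Measurement a) (ψ : Matrix (Basis a) (Basis b) ℂ) :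
    (M.K false)ᴴ * (M.K false * ψ) + (M.K true)ᴴ * (M.K true * ψ) = ψ := by
  rw [← Matrix.mul_assoc, ← Matrix.mul_assoc, ← Matrix.add_mul, M.complete, Matrix.one_mul]

theorem Measurement.sum_conj_right (M : Measurement b) (ψ : Matrix (Basis a) (Basis b) ℂ) :
    ψ * (M.K false)ᵀ * ((M.K false)ᴴ)ᵀ + ψ * (M.K true)ᵀ * ((M.K true)ᴴ)ᵀ = ψ := by
  have h := congrArg Matrix.transpose (M.sum_conj ψᵀ)
  simpa [Matrix.transpose_mul] using h

/-- An outcome that is certain leaves the state unchanged. -/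
theorem Measurement.conj_of_certain (M : Measurement a) {ψ : Matrix (Basis a) (Basis b) ℂ}
    {o : Bool} (h : normSq (M.K o * ψ) = normSq ψ) :
    (M.K o)ᴴ * (M.K o * ψ) = ψ ∧ M.K (!o) * ψ = 0 := by
  have h0 : M.K (!o) * ψ = 0 := by
    apply eq_zero_of_normSq_eq_zero
    have := M.normSq_add ψ
    cases o <;> simp only [Bool.not_false, Bool.not_true] <;> linarith
  refine ⟨?_, h0⟩
  have := M.sum_conj ψ
  cases o <;> simp only [Bool.not_false, Bool.not_true] at h0 <;> simpa [h0] using this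

theorem Measurement.conj_of_certain_right (M : Measurement b) {ψ : Matrix (Basis a) (Basis b) ℂ}
    {o : Bool} (h : normSq (ψ * (M.K o)ᵀ) = normSq ψ) :
    ψ * (M.K o)ᵀ * ((M.K o)ᴴ)ᵀ = ψ ∧ ψ * (M.K (!o))ᵀ = 0 := by
  have h' := M.conj_of_certain (ψ := ψᵀ) (o := o) (by
    rw [← normSq_transpose, normSq_transpose ψ]
    simpa [Matrix.transpose_mul] using h)
  have h1 := congrArg Matrix.transpose h'.1
  have h2 := congrArg Matrix.transpose h'.2
  refine ⟨?_, ?_⟩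
  · simpa [Matrix.transpose_mul] using h1
  · simpa [Matrix.transpose_mul] using h2

theorem Measurement.normSq_mul_le (M : Measurement a) (o : Bool)
    (ψ : Matrix (Basis a) (Basis b) ℂ) : normSq (M.K o * ψ) ≤ normSq ψ := by
  have := M.normSq_add ψ
  have := normSq_nonneg (M.K false * ψ)
  have := normSq_nonneg (M.K true * ψ)
  cases o <;> linarith

theorem Measurement.normSq_mul_le_right (M : Measurement b) (o : Bool)
    (ψ : Matrix (Basis a) (Basis b) ℂ) : normSq (ψ * (M.K o)ᵀ) ≤ normSq ψ := by
  have := M.normSq_add_right ψ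
  have := normSq_nonneg (ψ * (M.K false)ᵀ)
  have := normSq_nonneg (ψ * (M.K true)ᵀ)
  cases o <;> linarith

/-- The operator `(Aᴴ A) ⊗ (Bᴴ B)`, for the measurement operators `A`, `B` of the outcome `o`. -/
def leafEffect (MA : Measurement a) (MB : Measurement b) (o : Bool)
    (ψ : Matrix (Basis a) (Basis b) ℂ) : Matrix (Basis a) (Basis b) ℂ :=
  (MA.K o)ᴴ * (MA.K o * (ψ * (MB.K o)ᵀ)) * ((MB.K o)ᴴ)ᵀ

/-- The joint probability is at most Bob's, which is at most the norm; equality makes both outcomes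
certain. -/
theorem leafEffect_of_certain (MA : Measurement a) (MB : Measurement b) {o : Bool}
    {ψ : Matrix (Basis a) (Basis b) ℂ} (h : normSq (MA.K o * (ψ * (MB.K o)ᵀ)) = normSq ψ) :
    leafEffect MA MB o ψ = ψ ∧ leafEffect MA MB (!o) ψ = 0 := by
  have h1 := MA.normSq_mul_le o (ψ * (MB.K o)ᵀ)
  have h2 := MB.normSq_mul_le_right o ψ
  obtain ⟨hB, hB0⟩ := MB.conj_of_certain_right (le_antisymm h2 (h ▸ h1))
  obtain ⟨hA, -⟩ := MA.conj_of_certain (ψ := ψ * (MB.K o)ᵀ) (o := o) (by linarith)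
  simp [leafEffect, hA, hB, hB0]

theorem sum_basis_succ {E : Type*} [AddCommMonoid E] (F : Basis (a + 1) → E) :
    ∑ s, F s = ∑ i : Bool, ∑ s : Basis a, F (Fin.cons i s) := by
  rw [← Fintype.sum_prod_type', ← (Fin.consEquiv fun _ : Fin (a + 1) => Bool).sum_comp]
  rfl

theorem normSq_toBob (ψ : Matrix (Basis (a + 1)) (Basis b) ℂ) :
    normSq (toBob ψ) = normSq ψ := by
  simp only [normSq, toBob, sum_basis_succ, Fin.cons_zero, Fin.tail_cons]
  rw [Finset.sum_comm]

theorem normSq_toAlice (ψ : Matrix (Basis a) (Basis (b + 1)) ℂ) :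
    normSq (toAlice ψ) = normSq ψ := by
  simp only [normSq, toAlice, sum_basis_succ, Fin.cons_zero, Fin.tail_cons]
  rw [Finset.sum_comm]

theorem toAlice_toBob (ψ : Matrix (Basis (a + 1)) (Basis b) ℂ) : toAlice (toBob ψ) = ψ := by
  ext s t
  simp [toAlice, toBob]

theorem toBob_toAlice (ψ : Matrix (Basis a) (Basis (b + 1)) ℂ) : toBob (toAlice ψ) = ψ := by
  ext s t
  simp [toAlice, toBob]

theorem toAlice_zero : toAlice (0 : Matrix (Basis a) (Basis (b + 1)) ℂ) = 0 := rfl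

theorem toBob_zero : toBob (0 : Matrix (Basis (a + 1)) (Basis b) ℂ) = 0 := rfl

/-- The operator `⟨i| ⊗ 1` that projects the first qubit onto `|i⟩` and discards it. -/
def dropQubit (a : ℕ) (i : Bool) : Matrix (Basis a) (Basis (a + 1)) ℂ :=
  Matrix.of fun s r => if Fin.cons i s = r then 1 else 0

theorem dropQubit_mul (i : Bool) {β : Type*} (ψ : Matrix (Basis (a + 1)) β ℂ) (s : Basis a)
    (t : β) : (dropQubit a i * ψ) s t = ψ (Fin.cons i s) t := by
  simp [dropQubit, Matrix.mul_apply]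

theorem mul_dropQubit (i : Bool) {α : Type*} (ψ : Matrix α (Basis b) ℂ) (s : α)
    (t : Basis (b + 1)) :
    (ψ * dropQubit b i) s t = if t 0 = i then ψ s (Fin.tail t) else 0 := by
  simp only [dropQubit, Matrix.mul_apply, Matrix.of_apply]
  rw [Finset.sum_eq_single (Fin.tail t)]
  · by_cases h : t 0 = i
    · simp [← h]
    · rw [if_neg h, if_neg, mul_zero]
      exact fun e => h (congrFun e 0).symm
  · intro r _ hr
    rw [if_neg, mul_zero]
    rintro rfl
    simp at hr
  · simp

/-- Handing over a qubit thus has operator rank at most two, one term per basis state of that qubit.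
-/
theorem toBob_eq_sum (ψ : Matrix (Basis (a + 1)) (Basis b) ℂ) :
    toBob ψ = ∑ i, dropQubit a i * ψ * dropQubit b i := by
  ext s t
  simp [Matrix.sum_apply, mul_dropQubit, dropQubit_mul, toBob]

theorem toAlice_eq_transpose (ψ : Matrix (Basis a) (Basis (b + 1)) ℂ) :
    toAlice ψ = (toBob ψᵀ)ᵀ := rfl

theorem toAlice_eq_sum (ψ : Matrix (Basis a) (Basis (b + 1)) ℂ) :
    toAlice ψ = ∑ i, (dropQubit a i)ᵀ * ψ * (dropQubit b i)ᵀ := by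
  rw [toAlice_eq_transpose, toBob_eq_sum, Matrix.transpose_sum]
  simp [Matrix.transpose_mul, Matrix.mul_assoc]

end States

/-! ### Effects of protocols: operator rank and action on the initial state. -/

section Protocols

variable {X Y : Type}

theorem hasOperatorRank_leafEffect {a b : ℕ} (MA : X → Measurement a) (MB : Y → Measurement b)
    (o : Bool) : HasOperatorRank 1 (fun x y => leafEffect (MA x) (MB y) o) :=
  ⟨Unit, inferInstance, fun _ x => ((MA x).K o)ᴴ * (MA x).K o,
    fun _ y => ((MB y).K o)ᵀ * (((MB y).K o)ᴴ)ᵀ, by simp,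
    fun x y ψ => by simp [leafEffect, Matrix.mul_assoc]⟩

namespace ClassicalChannelProtocol

variable {a b : ℕ}

/-- The operator `∑ Wᴴ W`, over the operators `W` that take an initial state to the final state
at a leaf, both parties having output `o`. -/
def effect (o : Bool) : ClassicalChannelProtocol X Y a b → X → Y →
    Matrix (Basis a) (Basis b) ℂ → Matrix (Basis a) (Basis b) ℂ
  | output MA MB, x, y, ψ => leafEffect (MA x) (MB y) o ψ
  | alice M next, x, y, ψ =>
      ((M x).K false)ᴴ * effect o (next false) x y ((M x).K false * ψ) +
        ((M x).K true)ᴴ * effect o (next true) x y ((M x).K true * ψ)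
  | bob M next, x, y, ψ =>
      effect o (next false) x y (ψ * ((M y).K false)ᵀ) * (((M y).K false)ᴴ)ᵀ +
        effect o (next true) x y (ψ * ((M y).K true)ᵀ) * (((M y).K true)ᴴ)ᵀ

/-- Measurement operators depend on one input and leave the rank bound unchanged; the bounds for the
two branches of a node add up. -/
theorem hasOperatorRank_effect (o : Bool) (P : ClassicalChannelProtocol X Y a b) :
    HasOperatorRank (2 ^ P.cost) (P.effect o) := by
  induction P with
  | output MA MB => exact hasOperatorRank_leafEffect MA MB o
  | alice M next ih =>
    refine HasOperatorRank.mono (((ih false).mul_left (fun x => ((M x).K false)ᴴ)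
      (fun x => (M x).K false)).add ((ih true).mul_left (fun x => ((M x).K true)ᴴ)
      (fun x => (M x).K true))) ?_
    rw [cost, pow_succ, mul_two]
    exact add_le_add (Nat.pow_le_pow_right two_pos (le_max_left _ _))
      (Nat.pow_le_pow_right two_pos (le_max_right _ _))
  | bob M next ih =>
    refine HasOperatorRank.mono (((ih false).mul_right (fun y => (((M y).K false)ᴴ)ᵀ)
      (fun y => ((M y).K false)ᵀ)).add ((ih true).mul_right (fun y => (((M y).K true)ᴴ)ᵀ)
      (fun y => ((M y).K true)ᵀ))) ?_
    rw [cost, pow_succ, mul_two]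
    exact add_le_add (Nat.pow_le_pow_right two_pos (le_max_left _ _))
      (Nat.pow_le_pow_right two_pos (le_max_right _ _))

theorem prob_le_normSq (P : ClassicalChannelProtocol X Y a b) (x : X) (y : Y) (o : Bool)
    (ψ : Matrix (Basis a) (Basis b) ℂ) : P.prob ψ x y o ≤ normSq ψ := by
  induction P generalizing ψ with
  | output MA MB =>
    simp only [prob, applyAlice_eq_mul, applyBob_eq_mul]
    exact ((MA x).normSq_mul_le o _).trans ((MB y).normSq_mul_le_right o ψ)
  | alice M next ih =>
    simp only [prob, applyAlice_eq_mul]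
    exact (add_le_add (ih _ _) (ih _ _)).trans_eq ((M x).normSq_add ψ)
  | bob M next ih =>
    simp only [prob, applyBob_eq_mul]
    exact (add_le_add (ih _ _) (ih _ _)).trans_eq ((M y).normSq_add_right ψ)

/-- Each branch has probability at most its squared norm, and these norms add up to that of `ψ`; so
certainty passes to every branch, and completeness of the measurement reassembles `ψ`. -/
theorem effect_of_certain (P : ClassicalChannelProtocol X Y a b) (x : X) (y : Y) (o : Bool)
    (ψ : Matrix (Basis a) (Basis b) ℂ) (h : P.prob ψ x y o = normSq ψ) :
    P.effect o x y ψ = ψ ∧ P.effect (!o) x y ψ = 0 := by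
  induction P generalizing ψ with
  | output MA MB =>
    simp only [prob, applyAlice_eq_mul, applyBob_eq_mul] at h
    exact leafEffect_of_certain _ _ h
  | alice M next ih =>
    simp only [prob, applyAlice_eq_mul] at h
    have h0 := (next false).prob_le_normSq x y o ((M x).K false * ψ)
    have h1 := (next true).prob_le_normSq x y o ((M x).K true * ψ)
    have h2 := (M x).normSq_add ψ
    obtain ⟨e0, f0⟩ := ih false _ (by linarith)
    obtain ⟨e1, f1⟩ := ih true _ (by linarith)
    simp only [effect, e0, e1, f0, f1]
    exact ⟨(M x).sum_conj ψ, by simp⟩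
  | bob M next ih =>
    simp only [prob, applyBob_eq_mul] at h
    have h0 := (next false).prob_le_normSq x y o (ψ * ((M y).K false)ᵀ)
    have h1 := (next true).prob_le_normSq x y o (ψ * ((M y).K true)ᵀ)
    have h2 := (M y).normSq_add_right ψ
    obtain ⟨e0, f0⟩ := ih false _ (by linarith)
    obtain ⟨e1, f1⟩ := ih true _ (by linarith)
    simp only [effect, e0, e1, f0, f1]
    exact ⟨(M y).sum_conj_right ψ, by simp⟩

end ClassicalChannelProtocol

namespace QuantumChannelProtocol

/-- The operator `Wᴴ W`, where `W` takes an initial state to the final state, both parties having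
output `o`. -/
def effect (o : Bool) {a b : ℕ} : QuantumChannelProtocol X Y a b → X → Y →
    Matrix (Basis a) (Basis b) ℂ → Matrix (Basis a) (Basis b) ℂ
  | output MA MB, x, y, ψ => leafEffect (MA x) (MB y) o ψ
  | alice U next, x, y, ψ => (U x).1ᴴ * toAlice (effect o next x y (toBob ((U x).1 * ψ)))
  | bob U next, x, y, ψ => toBob (effect o next x y (toAlice (ψ * (U y).1ᵀ))) * ((U y).1ᴴ)ᵀ

/-- Each qubit is transferred once in `W` and once back in `Wᴴ`, with a factor two each time. -/
theorem hasOperatorRank_effect (o : Bool) {a b : ℕ} (P : QuantumChannelProtocol X Y a b) :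
    HasOperatorRank (4 ^ P.cost) (P.effect o) := by
  induction P with
  | output MA MB => exact hasOperatorRank_leafEffect MA MB o
  | alice U next ih =>
    have h := (ih.conj (dropQubit _) (dropQubit _) (fun j => (dropQubit _ j)ᵀ)
      (fun j => (dropQubit _ j)ᵀ)).mul_left (fun x => (U x).1ᴴ) (fun x => (U x).1)
    simp only [← toBob_eq_sum, ← toAlice_eq_sum] at h
    exact h.mono (by rw [cost, pow_succ, mul_comm])
  | bob U next ih =>
    have h := (ih.conj (fun j => (dropQubit _ j)ᵀ) (fun j => (dropQubit _ j)ᵀ) (dropQubit _)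
      (dropQubit _)).mul_right (fun y => ((U y).1ᴴ)ᵀ) (fun y => (U y).1ᵀ)
    simp only [← toBob_eq_sum, ← toAlice_eq_sum] at h
    exact h.mono (by rw [cost, pow_succ, mul_comm])

theorem effect_of_certain {a b : ℕ} (P : QuantumChannelProtocol X Y a b) (x : X) (y : Y) (o : Bool)
    (ψ : Matrix (Basis a) (Basis b) ℂ) (h : P.prob ψ x y o = normSq ψ) :
    P.effect o x y ψ = ψ ∧ P.effect (!o) x y ψ = 0 := by
  induction P with
  | output MA MB =>
    simp only [prob, applyAlice_eq_mul, applyBob_eq_mul] at h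
    exact leafEffect_of_certain _ _ h
  | alice U next ih =>
    have hU : (U x).1ᴴ * (U x).1 = 1 := Matrix.mem_unitaryGroup_iff'.1 (U x).2
    simp only [prob, applyAlice_eq_mul] at h
    obtain ⟨e, f⟩ := ih _ (by rw [h, normSq_toBob, normSq_mul_unitary hU])
    simp only [effect, e, f, toAlice_toBob, toAlice_zero]
    exact ⟨by rw [← Matrix.mul_assoc, hU, Matrix.one_mul], by simp⟩
  | bob U next ih =>
    have hU : (U y).1ᴴ * (U y).1 = 1 := Matrix.mem_unitaryGroup_iff'.1 (U y).2
    have hUt : (U y).1ᵀ * ((U y).1ᴴ)ᵀ = 1 := by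
      rw [← Matrix.transpose_mul, hU, Matrix.transpose_one]
    simp only [prob, applyBob_eq_mul] at h
    obtain ⟨e, f⟩ := ih _ (by
      rw [h, normSq_toAlice, ← normSq_transpose (ψ * _), Matrix.transpose_mul,
        Matrix.transpose_transpose, normSq_mul_unitary hU, normSq_transpose])
    simp only [effect, e, f, toBob_toAlice, toBob_zero]
    exact ⟨by rw [Matrix.mul_assoc, hUt, Matrix.mul_one], by simp⟩

end QuantumChannelProtocol

namespace DetProtocol

/-- The output of a deterministic protocol, as an operator on a one-dimensional space. -/
theorem hasOperatorRank_run (P : DetProtocol X Y) :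
    HasOperatorRank (2 ^ P.cost) (fun x y (ψ : Matrix Unit Unit ℂ) =>
      (if P.run x y then (1 : ℂ) else 0) • ψ) := by
  induction P with
  | output b =>
    exact ⟨Unit, inferInstance, fun _ _ => if b then 1 else 0, fun _ _ => 1, by simp [cost],
      fun x y ψ => by cases b <;> simp [run]⟩
  | alice msg next ih =>
    -- The indicator of the bit sent, which depends on one input, selects the branch.
    have h := ((ih false).mul_left (fun x => if msg x then 0 else 1) 1).add
      ((ih true).mul_left (fun x => if msg x then 1 else 0) 1)
    refine HasOperatorRank.mono
      (?_ : HasOperatorRank (2 ^ (next false).cost + 2 ^ (next true).cost) _) ?_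
    · convert h using 4 with x y ψ
      cases hm : msg x <;> simp [run, hm]
    · rw [cost, pow_succ, mul_two]
      exact add_le_add (Nat.pow_le_pow_right two_pos (le_max_left _ _))
        (Nat.pow_le_pow_right two_pos (le_max_right _ _))
  | bob msg next ih =>
    have h := ((ih false).mul_right (fun y => if msg y then 0 else 1) 1).add
      ((ih true).mul_right (fun y => if msg y then 1 else 0) 1)
    refine HasOperatorRank.mono
      (?_ : HasOperatorRank (2 ^ (next false).cost + 2 ^ (next true).cost) _) ?_
    · convert h using 4 with x y ψ
      cases hm : msg y <;> simp [run, hm]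
    · rw [cost, pow_succ, mul_two]
      exact add_le_add (Nat.pow_le_pow_right two_pos (le_max_left _ _))
        (Nat.pow_le_pow_right two_pos (le_max_right _ _))

end DetProtocol

end Protocols

theorem normSq_initial (m v w : ℕ) : normSq (initial m v w) = 1 := by
  -- Only strings whose private part is zero contribute. Then each of the `2 ^ m` rows has a single
  -- nonzero amplitude, of squared modulus `(1 / 2) ^ m`.
  have hsum : ∀ k (F : Basis (m + k) → ℝ),
      (∀ s, ¬ (∀ j : Fin k, s (Fin.natAdd m j) = false) → F s = 0) →
      ∑ s, F s = ∑ u : Basis m, F (Fin.append u fun _ => false) := by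
    intro k F hF
    rw [← (Fin.appendEquiv m k).sum_comp, Fintype.sum_prod_type]
    refine Finset.sum_congr rfl fun u _ => ?_
    refine Finset.sum_eq_single (fun _ => false) (fun z _ hz => hF _ fun h => hz ?_) (by simp)
    funext j
    simpa [Fin.appendEquiv] using h j
  have hsq : ‖(((1 / Real.sqrt 2) ^ m : ℝ) : ℂ)‖ ^ 2 = (1 / 2) ^ m := by
    rw [Complex.norm_real, Real.norm_of_nonneg (by positivity), ← pow_mul, mul_comm, pow_mul,
      div_pow, one_pow, Real.sq_sqrt zero_le_two]
  unfold normSq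
  rw [hsum v]
  · have : ∀ u : Basis m, ∑ t, ‖initial m v w (Fin.append u fun _ => false) t‖ ^ 2
        = (1 / 2 : ℝ) ^ m := by
      intro u
      rw [hsum w]
      · rw [Finset.sum_eq_single u]
        · rw [← hsq, initial, if_pos]
          simp
        · intro u' _ hu'
          rw [initial, if_neg]
          · simp
          · rintro ⟨h, -⟩
            apply hu'
            funext i
            simpa using (h i).symm
        · simp
      · intro t ht
        rw [initial, if_neg fun h => ht h.2.2]
        simp
    simp only [this, Finset.sum_const, Finset.card_univ, nsmul_eq_mul]
    simp
  · intro s hs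
    refine Finset.sum_eq_zero fun t _ => ?_
    rw [initial, if_neg fun h => hs h.2.1]
    simp

theorem initial_ne_zero (m v w : ℕ) : initial m v w ≠ 0 := by
  intro h
  have := normSq_initial m v w
  rw [h, normSq_zero] at this
  exact zero_ne_one this

/-! ### Consecutive coefficients of `(1 - X)^i (1 + X)^j`. -/

section Krawtchouk

open Polynomial

/-- The generating polynomial `(1 - X)^i (1 + X)^j` of the values of Krawtchouk polynomials. -/
noncomputable def krawtchoukGen (i j : ℕ) : ℤ[X] := (1 - X) ^ i * (1 + X) ^ j

/-- The logarithmic derivative is `-i / (1 - X) + j / (1 + X)`, cleared here of denominators. -/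
theorem krawtchoukGen_ode (i j : ℕ) :
    (1 - X * X) * derivative (krawtchoukGen i j) =
      C ((j : ℤ) - i) * krawtchoukGen i j - C ((i : ℤ) + j) * (X * krawtchoukGen i j) := by
  have h1 : ((1 - X) * derivative ((1 - X) ^ i) : ℤ[X]) = -(i : ℤ[X]) * (1 - X) ^ i := by
    cases i with
    | zero => simp
    | succ i => rw [derivative_pow_succ]; simp; ring
  have h2 : ((1 + X) * derivative ((1 + X) ^ j) : ℤ[X]) = (j : ℤ[X]) * (1 + X) ^ j := by
    cases j with
    | zero => simp
    | succ j => rw [derivative_pow_succ]; simp; ring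
  simp only [krawtchoukGen, derivative_mul, map_sub, map_add, map_natCast]
  linear_combination (1 + X) * (1 + X) ^ j * h1 + (1 - X) * (1 - X) ^ i * h2

/-- The coefficient of `X^(l+1)` in the differential equation reads `(l+2) c_{l+2} = (j-i) c_{l+1} +
(l-i-j) c_l`. -/
theorem krawtchoukGen_coeff_step {i j l : ℕ} (h0 : (krawtchoukGen i j).coeff l = 0)
    (h1 : (krawtchoukGen i j).coeff (l + 1) = 0) : (krawtchoukGen i j).coeff (l + 2) = 0 := by
  have h := congrArg (fun p => coeff p (l + 1)) (krawtchoukGen_ode i j)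
  simp only [sub_mul, one_mul, coeff_sub, mul_assoc, coeff_X_mul, coeff_C_mul, h0, h1] at h
  have h2 : (X * derivative (krawtchoukGen i j)).coeff l = 0 := by
    cases l with
    | zero => simp
    | succ l => simp [coeff_X_mul, coeff_derivative, h0]
  rw [h2, coeff_derivative] at h
  simp only [mul_zero, sub_zero, mul_eq_zero] at h
  refine h.resolve_right ?_
  positivity

theorem krawtchoukGen_coeff_top (i j : ℕ) : (krawtchoukGen i j).coeff (i + j) ≠ 0 := by
  have h1 : (1 - X : ℤ[X]) = C (-1) * (X - C 1) := by simp
  have h2 : (1 + X : ℤ[X]) = X + C 1 := by simp [add_comm]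
  have hmonic : ((X - C 1 : ℤ[X]) ^ i * (X + C 1) ^ j).Monic :=
    ((monic_X_sub_C 1).pow i).mul ((monic_X_add_C 1).pow j)
  have hd : ((X - C 1 : ℤ[X]) ^ i * (X + C 1) ^ j).natDegree = i + j := by
    rw [((monic_X_sub_C 1).pow i).natDegree_mul ((monic_X_add_C 1).pow j),
      (monic_X_sub_C 1).natDegree_pow, (monic_X_add_C 1).natDegree_pow, natDegree_X_sub_C,
      natDegree_X_add_C, mul_one, mul_one]
  rw [krawtchoukGen, h1, h2, mul_pow, ← C_pow, mul_assoc, coeff_C_mul, ← hd,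
    hmonic.coeff_natDegree]
  simp

/-- Two consecutive coefficients of `(1 - X)^i (1 + X)^j`, up to the degree, do not both vanish. -/
theorem krawtchoukGen_coeff_ne_zero {i j l : ℕ} (hl : l ≤ i + j + 1)
    (h0 : (krawtchoukGen i j).coeff l = 0) : (X * krawtchoukGen i j).coeff l ≠ 0 := by
  intro h1
  cases l with
  | zero => simp [krawtchoukGen, coeff_zero_eq_eval_zero] at h0
  | succ l =>
    rw [coeff_X_mul] at h1
    -- Two adjacent zeros propagate upwards to the leading coefficient, which is `±1`.
    have hall : ∀ d, (krawtchoukGen i j).coeff (l + d) = 0 ∧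
        (krawtchoukGen i j).coeff (l + d + 1) = 0 := by
      intro d
      induction d with
      | zero => exact ⟨h1, h0⟩
      | succ d ih => exact ⟨ih.2, krawtchoukGen_coeff_step ih.1 ih.2⟩
    obtain ⟨d, hd⟩ := Nat.exists_eq_add_of_le (Nat.le_of_succ_le_succ hl)
    exact krawtchoukGen_coeff_top i j (hd ▸ (hall d).1)

/-- Taking partial sums of coefficients is division by `1 - X`; this turns Hamming spheres into
balls. -/
theorem sum_coeff_one_sub_X_mul (r : ℤ[X]) (l : ℕ) :
    ∑ k ∈ Finset.range (l + 1), ((1 - X) * r).coeff k = r.coeff l := by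
  induction l with
  | zero => simp [sub_mul]
  | succ l ih => rw [Finset.sum_range_succ, ih]; simp [sub_mul, coeff_X_mul]

end Krawtchouk

/-! ### Walsh diagonalization of `ham` and its eigenvalues. -/

section Fourier

variable {n : ℕ}

/-- The Hamming weight of a bit string. -/
def weight (z : Fin n → Bool) : ℕ := ∑ i, (z i).toNat

/-- The character `z ↦ (-1) ^ ⟨S, z⟩` of the group of bit strings. -/
def walsh (S z : Fin n → Bool) : ℤ := ∏ i, if S i && z i then -1 else 1

/-- The (not normalized) Fourier coefficient at `S` of the indicator of the Hamming ball of
radius `a`. -/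
def ballFourier (a : ℕ) (S : Fin n → Bool) : ℤ := ∑ z, walsh S z * if weight z ≤ a then 1 else 0

theorem walsh_xor (S z y : Fin n → Bool) :
    walsh S (fun i => xor (z i) (y i)) = walsh S z * walsh S y := by
  rw [walsh, walsh, walsh, ← Finset.prod_mul_distrib]
  refine Finset.prod_congr rfl fun i _ => ?_
  cases S i <;> cases z i <;> cases y i <;> rfl

theorem sum_walsh_mul_walsh (S T : Fin n → Bool) :
    ∑ y, walsh S y * walsh T y = if S = T then 2 ^ n else 0 := by
  simp only [walsh, ← Finset.prod_mul_distrib]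
  rw [← Fintype.prod_sum fun i b =>
    ((if S i && b then -1 else 1) * (if T i && b then -1 else 1) : ℤ)]
  split_ifs with h
  · subst h
    rw [Finset.prod_congr rfl (g := fun _ => (2 : ℤ))]
    · simp
    · intro i _
      cases S i <;> rfl
  · obtain ⟨i, hi⟩ := Function.ne_iff.1 h
    refine Finset.prod_eq_zero (Finset.mem_univ i) ?_
    revert hi
    cases S i <;> cases T i <;> simp

theorem hammingDist_xor (z y : Fin n → Bool) :
    hammingDist (fun i => xor (z i) (y i)) y = weight z := by
  rw [hammingDist, weight, Finset.card_filter]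
  refine Finset.sum_congr rfl fun i _ => ?_
  cases z i <;> cases y i <;> rfl

/-- Substituting `x = z + y` modulo 2 makes `ham` depend on `z` alone and splits the character;
orthogonality in `y` does the rest. -/
theorem sum_walsh_ham (a : ℕ) (S T : Fin n → Bool) :
    ∑ x, ∑ y, walsh S x * (if ham n a x y then 1 else 0) * walsh T y =
      if S = T then 2 ^ n * ballFourier a S else 0 := by
  rw [Finset.sum_comm]
  have h : ∀ y, ∑ x, walsh S x * (if ham n a x y then 1 else 0) * walsh T y =
      ballFourier a S * (walsh S y * walsh T y) := by
    intro y
    have hinv : Function.Involutive fun (z : Fin n → Bool) i => xor (z i) (y i) := by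
      intro z
      simp
    rw [← Equiv.sum_comp hinv.toPerm, ballFourier, Finset.sum_mul]
    refine Finset.sum_congr rfl fun z _ => ?_
    simp only [Function.Involutive.coe_toPerm, walsh_xor, ham, hammingDist_xor, decide_eq_true_eq]
    ring
  simp only [h, ← Finset.mul_sum, sum_walsh_mul_walsh]
  split_ifs <;> ring

open Polynomial in
theorem sum_walsh_mul_X_pow_weight (S : Fin n → Bool) :
    ∑ z, C (walsh S z) * X ^ weight z = ∏ i, (if S i then 1 - X else 1 + X : ℤ[X]) := by
  have h : ∀ i, (if S i then 1 - X else 1 + X : ℤ[X]) =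
      ∑ b : Bool, C (if S i && b then -1 else 1) * X ^ b.toNat := by
    intro i
    cases S i <;> simp <;> ring
  simp only [h]
  rw [Fintype.prod_sum]
  refine Finset.sum_congr rfl fun z _ => ?_
  rw [Finset.prod_mul_distrib, Finset.prod_pow_eq_pow_sum, walsh, map_prod, weight]

open Polynomial in
theorem ballFourier_eq_sum_coeff (a : ℕ) (S : Fin n → Bool) :
    ballFourier a S = ∑ k ∈ Finset.range (a + 1),
      (∏ i, (if S i then 1 - X else 1 + X : ℤ[X])).coeff k := by
  simp only [← sum_walsh_mul_X_pow_weight, finsetSum_coeff, coeff_C_mul, coeff_X_pow]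
  rw [Finset.sum_comm, ballFourier]
  refine Finset.sum_congr rfl fun z _ => ?_
  rw [← Finset.mul_sum, Finset.sum_ite_eq' ]
  simp

/-- At the trivial character the coefficient is the size of the ball. This case is separate because
its generating polynomial has no factor `1 - X` to cancel. -/
theorem ballFourier_zero_ne_zero (a : ℕ) : ballFourier a (fun _ : Fin n => false) ≠ 0 := by
  have hw : ∀ z : Fin n → Bool, walsh (fun _ => false) z = 1 := fun z => by simp [walsh]
  refine ne_of_gt (Finset.sum_pos' (fun z _ => ?_) ⟨fun _ => false, Finset.mem_univ _, ?_⟩)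
  · rw [hw]; positivity
  · rw [hw]; simp [weight]

open Polynomial in
theorem exists_ballFourier_cons_ne_zero {a : ℕ} (ha : a ≤ n) (u : Fin n → Bool) :
    ∃ b, ballFourier a (Fin.cons b u : Fin (n + 1) → Bool) ≠ 0 := by
  by_cases hu : ∀ i, u i = false
  · refine ⟨false, ?_⟩
    convert ballFourier_zero_ne_zero (n := n + 1) a using 2
    funext i
    refine Fin.cases rfl (fun i => ?_) i
    simp [hu]
  push Not at hu
  obtain ⟨i₀, hi₀⟩ := hu
  let s := Finset.univ.filter fun i => u i = true
  let t := Finset.univ.filter fun i => ¬ u i = true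
  have hst : s.card + t.card = n :=
    (Finset.card_filter_add_card_filter_not (s := Finset.univ) fun i => u i = true).trans (by simp)
  obtain ⟨k, hk⟩ : ∃ k, s.card = k + 1 :=
    Nat.exists_eq_succ_of_ne_zero (Finset.card_ne_zero_of_mem (a := i₀) (by simp [s, hi₀]))
  -- As `u ≠ 0`, one factor `1 - X` can be set aside for the summation over the ball.
  have hprod : ∏ i, (if u i then 1 - X else 1 + X : ℤ[X]) =
      (1 - X) * krawtchoukGen k t.card := by
    rw [Finset.prod_ite, Finset.prod_const, Finset.prod_const, krawtchoukGen]
    change (1 - X) ^ s.card * (1 + X) ^ t.card = _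
    rw [hk]
    ring
  have hb : ∀ b : Bool, ballFourier a (Fin.cons b u : Fin (n + 1) → Bool) =
      ((if b then 1 - X else 1 + X) * krawtchoukGen k t.card).coeff a := by
    intro b
    rw [ballFourier_eq_sum_coeff]
    simp only [Fin.prod_univ_succ, Fin.cons_zero, Fin.cons_succ, hprod]
    rw [mul_left_comm, sum_coeff_one_sub_X_mul]
  -- The sum and difference of the two coefficients would make the coefficients of `X^a` in both `K`
  -- and `X K` vanish, for `K = krawtchoukGen k t.card`. Here `k + t.card + 1 = n`, so `a ≤ n` is
  -- exactly the range needed.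
  by_contra! hzero
  have h0 := (hb false).symm.trans (hzero false)
  have h1 := (hb true).symm.trans (hzero true)
  simp only [Bool.false_eq_true, if_false, if_true, add_mul, sub_mul, one_mul, coeff_add,
    coeff_sub] at h0 h1
  exact krawtchoukGen_coeff_ne_zero (i := k) (j := t.card) (l := a) (by omega) (by omega) (by omega)

end Fourier

/-! ### The three lower bounds. -/

/-- An operator-valued form of the log rank lower bound for the threshold Hamming distance. -/
theorem HasOperatorRank.two_pow_le {n a N : ℕ} (ha : a < n) {α β : Type*} [Fintype α] [Fintype β]
    {L : (Fin n → Bool) → (Fin n → Bool) → Matrix α β ℂ → Matrix α β ℂ} (h : HasOperatorRank N L)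
    {ψ : Matrix α β ℂ} (hψ : ψ ≠ 0)
    (hL : ∀ x y, L x y ψ = (if ham n a x y then (1 : ℂ) else 0) • ψ) : 2 ^ (n - 1) ≤ N := by
  obtain ⟨m, rfl⟩ : ∃ m, n = m + 1 := Nat.exists_eq_succ_of_ne_zero (by omega)
  -- One good first bit for each `u` yields `2 ^ m` distinct characters with nonzero eigenvalue.
  choose b hb using exists_ballFourier_cons_ne_zero (n := m) (a := a) (by omega)
  let σ : (Fin m → Bool) → Fin (m + 1) → Bool := fun u => Fin.cons (b u) u
  have hσ : ∀ u v, σ u = σ v ↔ u = v := fun u v =>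
    ⟨fun e => (Fin.cons_inj.1 e).2, fun e => e ▸ rfl⟩
  have := h.card_le hψ hL (fun u x => (walsh (σ u) x : ℂ)) (fun v y => (walsh (σ v) y : ℂ))
    (fun u => 2 ^ (m + 1) * (ballFourier a (σ u) : ℂ))
    (fun u => mul_ne_zero (pow_ne_zero _ two_ne_zero) (Int.cast_ne_zero.2 (hb u))) (fun u v => by
      have := congrArg (Int.cast : ℤ → ℂ) (sum_walsh_ham a (σ u) (σ v))
      simp only [hσ] at this
      push_cast at this
      exact this)
  simpa using this

theorem le_D_ham {n a : ℕ} (ha : a < n) : ((n - 1 : ℕ) : ℕ∞) ≤ D (ham n a) := by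
  refine le_iInf₂ fun P hP => ?_
  have h := P.hasOperatorRank_run.two_pow_le ha (ψ := 1) one_ne_zero fun x y => by rw [hP x y]
  exact_mod_cast (Nat.pow_le_pow_iff_right one_lt_two).1 h

theorem le_CStar_ham {n a : ℕ} (ha : a < n) : ((n - 1 : ℕ) : ℕ∞) ≤ CStar (ham n a) := by
  refine le_iInf fun m => le_iInf fun v => le_iInf fun w => le_iInf₂ fun P hP => ?_
  have h := (P.hasOperatorRank_effect true).two_pow_le ha (initial_ne_zero m v w) fun x y => by
    have := P.effect_of_certain x y _ _ ((hP x y).trans (normSq_initial m v w).symm)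
    cases hxy : ham n a x y <;> simp [hxy] at this <;> simp [this]
  exact_mod_cast (Nat.pow_le_pow_iff_right one_lt_two).1 h

theorem le_QStar_ham {n a : ℕ} (ha : a < n) : ((n / 2 : ℕ) : ℕ∞) ≤ QStar (ham n a) := by
  refine le_iInf fun m => le_iInf fun v => le_iInf fun w => le_iInf₂ fun P hP => ?_
  have h := (P.hasOperatorRank_effect true).two_pow_le ha (initial_ne_zero m v w) fun x y => by
    have := P.effect_of_certain x y _ _ ((hP x y).trans (normSq_initial m v w).symm)
    cases hxy : ham n a x y <;> simp [hxy] at this <;> simp [this]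
  rw [show 4 = 2 ^ 2 by rfl, ← pow_mul] at h
  have := (Nat.pow_le_pow_iff_right one_lt_two).1 h
  -- From `n - 1 ≤ 2 * P.cost`: rounding `(n - 1) / 2` up gives `n / 2` rounded down.
  exact_mod_cast (by omega : n / 2 ≤ P.cost)

theorem coe_le_coe_of_natCast_le {r : ℝ} {k : ℕ} {c : ℕ∞} (hr : r ≤ k) (hk : (k : ℕ∞) ≤ c) :
    (r : EReal) ≤ (c : EReal) := by
  refine (EReal.coe_le_coe_iff.2 hr).trans ?_
  have : ((k : ℕ∞) : EReal) ≤ (c : EReal) :=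
    EReal.coe_ennreal_le_coe_ennreal_iff.2 (ENat.toENNReal_le.2 hk)
  refine le_trans (le_of_eq ?_) this
  rw [ENat.toENNReal_coe]
  rw [← ENNReal.ofReal_natCast, EReal.coe_ennreal_ofReal, max_eq_left (Nat.cast_nonneg k)]

end CommComplexity

theorem theorem5p14 :
    ∃ N : ℕ, ∀ n : ℕ, N ≤ n → ∀ a : ℕ, a < n →
      (((n : ℝ) - 2 : ℝ) : EReal) ≤ (CommComplexity.D (CommComplexity.ham n a) : EReal) ∧
      (((n : ℝ) / 2 - 1 : ℝ) : EReal) ≤ (CommComplexity.QStar (CommComplexity.ham n a) : EReal) ∧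
      (((n : ℝ) - 2 : ℝ) : EReal) ≤ (CommComplexity.CStar (CommComplexity.ham n a) : EReal) := by
  -- No largeness of `n` is needed: the bounds `n - 1` and `⌊n / 2⌋` hold for all `a < n`.
  refine ⟨0, fun n _ a ha => ?_⟩
  have h1 : (n : ℝ) - 2 ≤ (n - 1 : ℕ) := by
    have : (n : ℝ) ≤ (n - 1 : ℕ) + 2 := by exact_mod_cast (by omega : n ≤ n - 1 + 2)
    linarith
  have h2 : (n : ℝ) / 2 - 1 ≤ (n / 2 : ℕ) := by
    have : (n : ℝ) ≤ 2 * (n / 2 : ℕ) + 2 := by exact_mod_cast (by omega : n ≤ 2 * (n / 2) + 2)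
    linarith
  exact ⟨CommComplexity.coe_le_coe_of_natCast_le h1 (CommComplexity.le_D_ham ha),
    CommComplexity.coe_le_coe_of_natCast_le h2 (CommComplexity.le_QStar_ham ha),
    CommComplexity.coe_le_coe_of_natCast_le h1 (CommComplexity.le_CStar_ham ha)⟩
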